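/- Let $X$ be a compact geodesic metric space (every two points are joined by a length-minimizing curve whose length is their distance) that is semilocally simply connected (every point $x$ has a neighborhood $U$ such that every loop in $U$ based at $x$ is null-homotopic in $X$). For $\varepsilon>0$, an $\varepsilon$-chain in $X$ is a finite sequence $x_0,\dots,x_n$ ($n\ge 0$) of points of $X$ with $d(x_i,x_{i+1})<\varepsilon$ for all $i$; it is an $\varepsilon$-loop if $x_n=x_0$. Two $\varepsilon$-chains with the same endpoints are $\varepsilon$-homotopic if one is obtained from the other by finitely many moves, each adding or removing a single point, such that every intermediate sequence is an $\varepsilon$-chain with the same endpoints. An $\varepsilon$-loop is $\varepsilon$-null if it is $\varepsilon$-homotopic to the one-point chain at its starting point. The homotopy critical spectrum of $X$ is the set of all $\varepsilon>0$ for which there is an $\varepsilon$-loop that is not $\varepsilon$-null but is $\delta$-null for every $\delta>\varepsilon$. For $g\in\pi_1(X,*)$, let $|g|\in[0,\infty]$ be the infimum of the lengths of the loops in the homotopy class $g$. For $L>0$, let $\Gamma(X,L)$ be the supremum, over all basepoints $*\in X$, of the number of distinct elements $g\in\pi_1(X,*)$ with $|g|\le L$. For $s>0$, let $C(X,s)$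 be the minimum number of open $s$-balls required to cover $X$. If $\varepsilon>0$ is a lower bound for the homotopy critical spectrum of $X$ (that is, $\varepsilon\le\sigma$ for every element $\sigma$ of the spectrum; every $\varepsilon>0$ is one if the spectrum is empty), then for every $L>0$, $$\Gamma(X,L)\;\le\; C\!\left(X,\tfrac{\varepsilon}{4}\right)^{4L/\varepsilon}.$$ -/

import Mathlib

open scoped ENNReal Topology

namespace DiscreteHomotopy

section Spaces

/-- A metric space is geodesic if any two points `x`, `y` are joined by a geodesic, that is, an
arclength parameterized length minimizing curve: a map of `[0, dist x y]` into the space that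
preserves distances. -/
def IsGeodesicSpace (X : Type*) [MetricSpace X] : Prop :=
  ∀ x y : X, ∃ c : ℝ → X, c 0 = x ∧ c (dist x y) = y ∧
    ∀ s ∈ Set.Icc 0 (dist x y), ∀ t ∈ Set.Icc 0 (dist x y), dist (c s) (c t) = |s - t|

/-- Every point has a neighborhood `U` such that each loop in `U` based at that point is
null-homotopic in the whole space (with fixed endpoints). -/
def IsSemilocallySimplyConnected (X : Type*) [TopologicalSpace X] : Prop :=
  ∀ x : X, ∃ U ∈ 𝓝 x, ∀ γ : Path x x, Set.range γ ⊆ U → γ.Homotopic (Path.refl x)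

end Spaces

section Chains

variable {X : Type*} [MetricSpace X]

/-- An `ε`-chain `{x₀, ..., xₙ}`: a nonempty finite sequence whose successive points are at
distance less than `ε`. -/
def IsEpsChain (ε : ℝ) (α : List X) : Prop :=
  α ≠ [] ∧ List.IsChain (fun x y => dist x y < ε) α

/-- An `ε`-loop is an `ε`-chain with equal first and last points. -/
def IsEpsLoop (ε : ℝ) (α : List X) : Prop :=
  IsEpsChain ε α ∧ α.head? = α.getLast?

/-- `β` is obtained from the `ε`-chain `α` by adding a single point; both are `ε`-chains and have
the same endpoints. -/
def AddsPoint (ε : ℝ) (α β : List X) : Prop :=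
  IsEpsChain ε α ∧ IsEpsChain ε β ∧ α.head? = β.head? ∧ α.getLast? = β.getLast? ∧
    ∃ (a b : List X) (p : X), α = a ++ b ∧ β = a ++ p :: b

/-- A basic move with fixed endpoints: adding or removing a single point. -/
def BasicMove (ε : ℝ) (α β : List X) : Prop :=
  AddsPoint ε α β ∨ AddsPoint ε β α

/-- `α` and `β` are `ε`-chains joined by a finite sequence of `ε`-chains with the same endpoints,
successive ones differing by a basic move. -/
def EpsHomotopic (ε : ℝ) (α β : List X) : Prop :=
  IsEpsChain ε α ∧ IsEpsChain ε β ∧ Relation.ReflTransGen (BasicMove ε) α β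

/-- A loop is `ε`-null if it is `ε`-homotopic to a trivial loop `{x₀}`; since `ε`-homotopies fix
endpoints, `x₀` is the first and last point of the loop. -/
def IsEpsNull (ε : ℝ) (α : List X) : Prop :=
  ∃ x₀ : X, EpsHomotopic ε α [x₀]

/-- An `ε`-loop is `ε`-critical if it is not `ε`-null but is `δ`-null for all `δ > ε`. -/
def IsEpsCritical (ε : ℝ) (α : List X) : Prop :=
  IsEpsLoop ε α ∧ ¬ IsEpsNull ε α ∧ ∀ δ : ℝ, ε < δ → IsEpsNull δ α

variable (X) in
/-- The homotopy critical spectrum: all `ε > 0` for which an `ε`-critical `ε`-loop exists. -/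
def homotopyCriticalSpectrum : Set ℝ :=
  {ε : ℝ | 0 < ε ∧ ∃ α : List X, IsEpsCritical ε α}

end Chains

section Counting

variable {X : Type*} [MetricSpace X]

/-- The length (possibly infinite) of a path in a metric space: the supremum of the lengths of
inscribed polygons. -/
noncomputable def pathLength {x y : X} (γ : Path x y) : ℝ≥0∞ :=
  eVariationOn (γ : unitInterval → X) Set.univ

/-- `|[c]|`: the infimum of the lengths of the paths in a fixed-endpoint homotopy class. -/
noncomputable def classLength {x y : X} (g : Path.Homotopic.Quotient x y) : ℝ≥0∞ :=
  ⨅ (γ : Path x y) (_ : Path.Homotopic.Quotient.mk γ = g), pathLength γ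

variable (X) in
/-- `Γ(X, L)`: the supremum over all basepoints of the number of elements `g` of the fundamental
group with `|g| ≤ L`. -/
noncomputable def shortClassCount (L : ℝ) : ℕ∞ :=
  ⨆ x : X, {g : FundamentalGroup X x | classLength g.toPath ≤ ENNReal.ofReal L}.encard

variable (X) in
/-- `C(X, s)`: the minimum number of open `s`-balls required to cover `X`. -/
noncomputable def openCoverNumber (s : ℝ) : ℕ∞ :=
  ⨅ (A : Set X) (_ : (⋃ a ∈ A, Metric.ball a s) = Set.univ), A.encard

end Counting

end DiscreteHomotopy

/-!
Subdivide a path of length less than `N * c` finely and group the subdivision points into `N` blocks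
of diameter about `c`. At each of the `N - 1` interior block ends, record a ball of a fixed cover
containing it. If two paths with the same ends have the same record, then the closed chain running
along one and back along the other is filled by a ladder of squares of diameter less than `ε`, so it
is `ε`-null. As there is no critical value below `ε`, it is `δ`-null for every `δ > 0`. By
compactness there is a scale `δ` at which short paths are determined up to homotopy by their
endpoints; a `δ`-chain then has a well-defined path class, which is invariant under `δ`-homotopy, so
the two paths are homotopic. Hence a path class is determined by its record.
-/

namespace DiscreteHomotopy

section Scale

variable {X : Type*} [MetricSpace X] {δ ε : ℝ} {α β : List X}

theorem IsEpsChain.mono (h : IsEpsChain δ α) (hδ : δ ≤ ε) : IsEpsChain ε α :=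
  ⟨h.1, h.2.imp fun _ _ hd => hd.trans_le hδ⟩

theorem AddsPoint.mono (h : AddsPoint δ α β) (hδ : δ ≤ ε) : AddsPoint ε α β :=
  ⟨h.1.mono hδ, h.2.1.mono hδ, h.2.2⟩

theorem BasicMove.mono (h : BasicMove δ α β) (hδ : δ ≤ ε) : BasicMove ε α β :=
  h.imp (·.mono hδ) (·.mono hδ)

theorem EpsHomotopic.mono (h : EpsHomotopic δ α β) (hδ : δ ≤ ε) : EpsHomotopic ε α β :=
  ⟨h.1.mono hδ, h.2.1.mono hδ, h.2.2.lift id fun _ _ hm => hm.mono hδ⟩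

theorem IsEpsNull.mono (h : IsEpsNull δ α) (hδ : δ ≤ ε) : IsEpsNull ε α :=
  h.imp fun _ hx => hx.mono hδ

theorem IsEpsChain.eventually_nhdsLT (h : IsEpsChain ε α) : ∀ᶠ δ in 𝓝[<] ε, IsEpsChain δ α := by
  obtain ⟨hne, hc⟩ := h
  suffices hchain : ∀ᶠ δ in 𝓝[<] ε, α.IsChain fun x y => dist x y < δ from
    hchain.mono fun _ hδ => ⟨hne, hδ⟩
  clear hne
  induction α using List.twoStepInduction with
  | nil => simp
  | singleton x => simp
  | cons_cons x y l _ ih =>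
    simp only [List.isChain_cons_cons] at hc ⊢
    exact ((eventually_gt_nhds hc.1).filter_mono nhdsWithin_le_nhds).and (ih y hc.2)

theorem AddsPoint.eventually_nhdsLT (h : AddsPoint ε α β) : ∀ᶠ δ in 𝓝[<] ε, AddsPoint δ α β := by
  filter_upwards [h.1.eventually_nhdsLT, h.2.1.eventually_nhdsLT] with δ hα hβ
  exact ⟨hα, hβ, h.2.2⟩

theorem BasicMove.eventually_nhdsLT (h : BasicMove ε α β) : ∀ᶠ δ in 𝓝[<] ε, BasicMove δ α β :=
  h.elim (fun h => h.eventually_nhdsLT.mono fun _ => .inl)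
    fun h => h.eventually_nhdsLT.mono fun _ => .inr

theorem EpsHomotopic.eventually_nhdsLT (h : EpsHomotopic ε α β) :
    ∀ᶠ δ in 𝓝[<] ε, EpsHomotopic δ α β := by
  obtain ⟨hα, hβ, hm⟩ := h
  have hmoves : ∀ᶠ δ in 𝓝[<] ε, Relation.ReflTransGen (BasicMove δ) α β := by
    clear hβ
    induction hm with
    | refl => exact .of_forall fun _ => .refl
    | tail _ hs ih => filter_upwards [ih, hs.eventually_nhdsLT] with δ using .tail
  filter_upwards [hα.eventually_nhdsLT, hβ.eventually_nhdsLT, hmoves] with δ hα hβ hm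
  exact ⟨hα, hβ, hm⟩

theorem IsEpsNull.exists_lt (h : IsEpsNull ε α) : ∃ δ < ε, IsEpsNull δ α := by
  obtain ⟨x, hx⟩ := h
  obtain ⟨δ, hδ, hlt⟩ := (hx.eventually_nhdsLT.and self_mem_nhdsWithin).exists
  exact ⟨δ, hlt, x, hδ⟩

/-- The critical value is the infimum of the scales at which the loop is null; it is not attained,
since nullity is an open condition on the scale. -/
theorem exists_mem_homotopyCriticalSpectrum (hδ : 0 < δ) (hα : IsEpsLoop δ α)
    (hnull : IsEpsNull ε α) (hnot : ¬ IsEpsNull δ α) :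
    ∃ σ ∈ homotopyCriticalSpectrum X, δ ≤ σ ∧ σ < ε := by
  let S : Set ℝ := {t | IsEpsNull t α}
  have hδS : δ ∈ lowerBounds S := fun t ht => le_of_not_ge fun hlt => hnot (ht.mono hlt)
  have hglb : IsGLB S (sInf S) := isGLB_csInf ⟨ε, hnull⟩ ⟨δ, hδS⟩
  have hle : δ ≤ sInf S := hglb.2 hδS
  have hnmem : sInf S ∉ S := fun h => by
    obtain ⟨t, ht, htS⟩ := IsEpsNull.exists_lt h
    exact (hglb.1 htS).not_gt ht
  refine ⟨sInf S, ⟨hδ.trans_le hle, α, ⟨hα.1.mono hle, hα.2⟩, hnmem, fun t ht => ?_⟩, hle,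
    (hglb.1 hnull).lt_of_ne fun h => hnmem (h ▸ hnull)⟩
  obtain ⟨s, hs, -, hst⟩ := hglb.exists_between ht
  exact IsEpsNull.mono hs hst.le

theorem IsEpsNull.of_mem_lowerBounds (hnull : IsEpsNull ε α)
    (hlower : ε ∈ lowerBounds (homotopyCriticalSpectrum X)) (hδ : 0 < δ) (hα : IsEpsLoop δ α) :
    IsEpsNull δ α := by
  by_contra hnot
  obtain ⟨σ, hσ, -, hlt⟩ := exists_mem_homotopyCriticalSpectrum hδ hα hnull hnot
  exact (hlower hσ).not_gt hlt

end Scale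

section ChainMoves

variable {X : Type*} [MetricSpace X] {ε : ℝ} {α β γ l r : List X} {a b p : X}

theorem AddsPoint.epsHomotopic (h : AddsPoint ε α β) : EpsHomotopic ε α β :=
  ⟨h.1, h.2.1, .single (.inl h)⟩

theorem EpsHomotopic.trans (h : EpsHomotopic ε α β) (h' : EpsHomotopic ε β γ) :
    EpsHomotopic ε α γ :=
  ⟨h.1, h'.2.1, h.2.2.trans h'.2.2⟩

theorem EpsHomotopic.symm (h : EpsHomotopic ε α β) : EpsHomotopic ε β α :=
  have : Std.Symm (BasicMove (X := X) ε) := ⟨fun _ _ hm => hm.symm⟩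
  ⟨h.2.1, h.1, Std.Symm.symm _ _ h.2.2⟩

theorem IsEpsChain.reverse (h : IsEpsChain ε α) : IsEpsChain ε α.reverse :=
  ⟨by simpa using h.1, by simpa [List.isChain_reverse, dist_comm] using h.2⟩

theorem AddsPoint.reverse (h : AddsPoint ε α β) : AddsPoint ε α.reverse β.reverse := by
  obtain ⟨hα, hβ, hhead, hlast, a, b, p, rfl, rfl⟩ := h
  refine ⟨hα.reverse, hβ.reverse, ?_, ?_, b.reverse, a.reverse, p, by simp, by simp⟩
  · rw [List.head?_reverse, List.head?_reverse, hlast]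
  · rw [List.getLast?_reverse, List.getLast?_reverse, hhead]

theorem EpsHomotopic.reverse (h : EpsHomotopic ε α β) : EpsHomotopic ε α.reverse β.reverse :=
  ⟨h.1.reverse, h.2.1.reverse,
    h.2.2.lift _ fun _ _ hm => hm.imp AddsPoint.reverse AddsPoint.reverse⟩

theorem addsPoint_after (h : IsEpsChain ε (l ++ a :: r)) (h' : IsEpsChain ε (l ++ a :: p :: r))
    (hlast : (a :: r).getLast? = (p :: r).getLast?) :
    AddsPoint ε (l ++ a :: r) (l ++ a :: p :: r) := by
  refine ⟨h, h', ?_, ?_, l ++ [a], r, p, by simp, by simp⟩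
  · cases l <;> simp
  · simp only [List.getLast?_append, hlast, List.getLast?_cons_cons]

theorem EpsHomotopic.remove (h : IsEpsChain ε (l ++ a :: p :: b :: r)) (hab : dist a b < ε) :
    EpsHomotopic ε (l ++ a :: p :: b :: r) (l ++ a :: b :: r) := by
  have h' : IsEpsChain ε (l ++ a :: b :: r) := by
    refine ⟨by simp, ?_⟩
    have hc := h.2
    simp only [List.isChain_append_cons_cons, List.isChain_cons_cons] at hc ⊢
    exact ⟨hc.1, hab, hc.2.2.2⟩
  exact (addsPoint_after h' h (by simp only [List.getLast?_cons_cons])).epsHomotopic.symm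

theorem EpsHomotopic.duplicate (hε : 0 < ε) (h : IsEpsChain ε (l ++ a :: r)) :
    EpsHomotopic ε (l ++ a :: r) (l ++ a :: a :: r) := by
  have h' : IsEpsChain ε (l ++ a :: a :: r) := by
    have hc := List.isChain_split.1 h.2
    exact ⟨by simp, List.isChain_append_cons_cons.2 ⟨hc.1, by simpa using hε, hc.2⟩⟩
  exact (addsPoint_after h h' rfl).epsHomotopic

end ChainMoves

section InitialSegment

variable {X : Type*}

/-- The list `y 0, ..., y n`, which turns a sequence of points into a chain. It has `n + 1`
entries. -/
def initialSegment (y : ℕ → X) (n : ℕ) : List X :=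
  (List.range (n + 1)).map y

/-- The chain that runs out along `y 0, ..., y m` and back along `z n, ..., z 0`. It compares two
sequences with common ends: when `y 0 = z 0` and `y m = z n` it is a loop, in which the turning
point occurs twice. -/
def roundTrip (y : ℕ → X) (m : ℕ) (z : ℕ → X) (n : ℕ) : List X :=
  initialSegment y m ++ (initialSegment z n).reverse

theorem initialSegment_succ (y : ℕ → X) (n : ℕ) :
    initialSegment y (n + 1) = initialSegment y n ++ [y (n + 1)] := by
  simp [initialSegment, List.range_succ]

theorem initialSegment_eq_append (y : ℕ → X) (n : ℕ) :
    initialSegment y n = (List.range n).map y ++ [y n] := by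
  simp [initialSegment, List.range_succ]

theorem isChain_initialSegment {R : X → X → Prop} {y : ℕ → X} {n : ℕ} :
    (initialSegment y n).IsChain R ↔ ∀ i < n, R (y i) (y (i + 1)) := by
  rw [initialSegment, List.isChain_map, List.isChain_range_succ]

theorem reverse_roundTrip (y : ℕ → X) (m : ℕ) (z : ℕ → X) (n : ℕ) :
    (roundTrip y m z n).reverse = roundTrip z n y m := by
  simp [roundTrip]

theorem isEpsLoop_roundTrip [MetricSpace X] {δ : ℝ} (hδ : 0 < δ) {y z : ℕ → X} {m n : ℕ}
    (hy : ∀ i < m, dist (y i) (y (i + 1)) < δ) (hz : ∀ i < n, dist (z i) (z (i + 1)) < δ)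
    (h₀ : y 0 = z 0) (h : y m = z n) : IsEpsLoop δ (roundTrip y m z n) := by
  have hzc : IsEpsChain δ (initialSegment z n) :=
    ⟨by simp [initialSegment], isChain_initialSegment.2 hz⟩
  refine ⟨⟨by simp [roundTrip, initialSegment], List.isChain_append.2
    ⟨isChain_initialSegment.2 hy, hzc.reverse.2, ?_⟩⟩, ?_⟩
  · simpa [initialSegment_eq_append, h] using hδ
  · simp [roundTrip, initialSegment, List.range_succ_eq_map, List.getLast?_append,
      List.getLast?_cons, h₀]

end InitialSegment

section Ladder

variable {X : Type*} [MetricSpace X] {c ε : ℝ} {y z : ℕ → X}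

/-- The indices `J 0 ≤ J 1 ≤ ...`, starting from `0`, cut the sequence `y` into blocks of diameter
less than `c`. Consecutive blocks share an endpoint, and blocks may be reduced to one point. -/
structure IsBlockDecomposition (c : ℝ) (y : ℕ → X) (J : ℕ → ℕ) : Prop where
  monotone : Monotone J
  zero : J 0 = 0
  dist_lt : ∀ k i j, J k ≤ i → i ≤ j → j ≤ J (k + 1) → dist (y i) (y j) < c

theorem IsBlockDecomposition.pos {J : ℕ → ℕ} (hJ : IsBlockDecomposition c y J) : 0 < c := by
  simpa using hJ.dist_lt 0 (J 0) (J 0) le_rfl le_rfl (hJ.monotone (Nat.zero_le _))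

theorem EpsHomotopic.collapse (hε : 0 < ε) {a b : ℕ} (hab : a ≤ b)
    (hy : ∀ i j, a ≤ i → i ≤ j → j ≤ b → dist (y i) (y j) < ε) (r : List X)
    (h : IsEpsChain ε (initialSegment y b ++ r)) :
    EpsHomotopic ε (initialSegment y b ++ r) (initialSegment y a ++ y b :: r) := by
  induction b, hab using Nat.le_induction generalizing r with
  | base =>
    rw [initialSegment_eq_append, List.append_assoc, List.append_assoc] at *
    exact .duplicate hε h
  | succ b hab ih =>
    rw [initialSegment_succ, List.append_assoc] at h ⊢
    have hih := ih (fun i j hi hij hj => hy i j hi hij (by omega)) _ h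
    refine hih.trans ?_
    have hchain := hih.2.1
    rw [initialSegment_eq_append, List.append_assoc] at hchain ⊢
    rw [List.append_assoc]
    exact .remove hchain (hy _ _ le_rfl (by omega) le_rfl)

theorem EpsHomotopic.roundTrip_left (hε : 0 < ε) {a b n : ℕ} (hab : a ≤ b)
    (hy : ∀ i j, a ≤ i → i ≤ j → j ≤ b → dist (y i) (y j) < ε) (hd : dist (y a) (z n) < ε)
    (h : IsEpsChain ε (roundTrip y b z n)) :
    EpsHomotopic ε (roundTrip y b z n) (roundTrip y a z n) := by
  have hcol := EpsHomotopic.collapse hε hab hy _ h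
  refine hcol.trans ?_
  replace hcol := hcol.2.1
  simp only [roundTrip, initialSegment_eq_append, List.reverse_append, List.reverse_singleton,
    List.append_assoc, List.singleton_append] at hcol ⊢
  exact .remove hcol hd

theorem EpsHomotopic.roundTrip_right (hε : 0 < ε) {a b m : ℕ} (hab : a ≤ b)
    (hz : ∀ i j, a ≤ i → i ≤ j → j ≤ b → dist (z i) (z j) < ε) (hd : dist (y m) (z a) < ε)
    (h : IsEpsChain ε (roundTrip y m z b)) :
    EpsHomotopic ε (roundTrip y m z b) (roundTrip y m z a) := by
  have hrev := h.reverse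
  rw [reverse_roundTrip] at hrev
  simpa only [reverse_roundTrip] using
    (EpsHomotopic.roundTrip_left hε hab hz (by rwa [dist_comm]) hrev).reverse

theorem IsEpsNull.of_ladder {s : ℝ} {J K : ℕ → ℕ} {N : ℕ} (hJ : IsBlockDecomposition c y J)
    (hK : IsBlockDecomposition c z K) (hs : s + c ≤ ε) (h₀ : y 0 = z 0)
    (hrung : ∀ k < N, dist (y (J k)) (z (K k)) < s)
    (h : IsEpsChain ε (roundTrip y (J N) z (K N))) :
    IsEpsNull ε (roundTrip y (J N) z (K N)) := by
  induction N with
  | zero =>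
    simp only [roundTrip, initialSegment, hJ.zero, hK.zero, zero_add, List.range_one, List.map_cons,
      List.map_nil, List.reverse_singleton, List.singleton_append, ← h₀] at h ⊢
    have hε : 0 < ε := by simpa using h.2
    exact ⟨y 0, (EpsHomotopic.duplicate (l := []) hε ⟨by simp, by simp⟩).symm⟩
  | succ N ih =>
    have hrungN := hrung N N.lt_succ_self
    have hcε : c ≤ ε := by linarith [dist_nonneg.trans_lt hrungN]
    have hdiag : dist (y (J N)) (z (K (N + 1))) < ε := by
      linarith [dist_triangle (y (J N)) (z (K N)) (z (K (N + 1))),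
        hK.dist_lt N _ _ le_rfl (hK.monotone N.le_succ) le_rfl]
    have hε : 0 < ε := hJ.pos.trans_le hcε
    have hleft := EpsHomotopic.roundTrip_left hε (hJ.monotone N.le_succ)
      (fun i j hi hij hj => (hJ.dist_lt N i j hi hij hj).trans_le hcε) hdiag h
    have hright := EpsHomotopic.roundTrip_right hε (hK.monotone N.le_succ)
      (fun i j hi hij hj => (hK.dist_lt N i j hi hij hj).trans_le hcε)
      (by linarith [hJ.pos]) hleft.2.1
    obtain ⟨x, hx⟩ := ih (fun k hk => hrung k (hk.trans N.lt_succ_self)) hright.2.1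
    exact ⟨x, hleft.trans (hright.trans hx)⟩

/-- `J k` is the first index at which `S` reaches `k * c`, capped at `M`. -/
theorem exists_monotone_sub_lt {S : ℕ → ℝ} (hS : Monotone S) (hS₀ : S 0 = 0) {η : ℝ}
    (hstep : ∀ i, S (i + 1) - S i < η) (hc : 0 ≤ c) {M N : ℕ} (hM : S M < N * c) :
    ∃ J : ℕ → ℕ, Monotone J ∧ J 0 = 0 ∧ J N = M ∧
      ∀ k i j, J k ≤ i → i ≤ j → j ≤ J (k + 1) → S j - S i < c + η := by
  classical
  have hη : 0 < η := (sub_nonneg.2 (hS (Nat.le_succ 0))).trans_lt (hstep 0)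
  have hex : ∀ k : ℕ, ∃ j, j = M ∨ k * c ≤ S j := fun k => ⟨M, .inl rfl⟩
  let J : ℕ → ℕ := fun k => Nat.find (hex k)
  have hJ : ∀ k, J k = M ∨ k * c ≤ S (J k) := fun k => Nat.find_spec (hex k)
  have hJM : ∀ k, J k ≤ M := fun k => Nat.find_min' _ (.inl rfl)
  have hbelow : ∀ k j, j < J k → S j < k * c := fun k j hj =>
    lt_of_not_ge fun hle => Nat.find_min (hex k) hj (.inr hle)
  refine ⟨J, monotone_nat_of_le_succ fun k => Nat.find_min' _ ?_,
    (Nat.find_eq_zero _).2 (.inr (by simp [hS₀])), ?_, ?_⟩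
  · refine (hJ (k + 1)).imp id fun h => le_trans ?_ h
    gcongr
    exact k.le_succ
  · exact (hJ N).resolve_right fun h => (h.trans (hS (hJM N))).not_gt hM
  · intro k i j hi hij hj
    rcases hij.eq_or_lt with rfl | hlt
    · linarith
    have hki : k * c ≤ S i := by
      refine ((hJ k).resolve_left fun h => ?_).trans (hS hi)
      have := hJM (k + 1)
      omega
    obtain ⟨j, rfl⟩ := Nat.exists_eq_succ_of_ne_zero (Nat.ne_zero_of_lt hlt)
    have hj' := hbelow (k + 1) j hj
    push_cast at hj'
    linarith [hstep j]

theorem exists_isBlockDecomposition {η : ℝ} (hstep : ∀ i, dist (y i) (y (i + 1)) < η) (hc : 0 ≤ c)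
    {M N : ℕ} (hsum : ∑ i ∈ Finset.range M, dist (y i) (y (i + 1)) < N * c) :
    ∃ J : ℕ → ℕ, J N = M ∧ IsBlockDecomposition (c + η) y J := by
  let S : ℕ → ℝ := fun n => ∑ i ∈ Finset.range n, dist (y i) (y (i + 1))
  have hsucc : ∀ i, S (i + 1) - S i = dist (y i) (y (i + 1)) := fun i =>
    sub_eq_of_eq_add' (Finset.sum_range_succ _ i)
  have hmono : Monotone S := monotone_nat_of_le_succ fun i =>
    sub_nonneg.1 (dist_nonneg.trans_eq (hsucc i).symm)
  obtain ⟨J, hJ, hJ₀, hJN, hblock⟩ :=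
    exists_monotone_sub_lt hmono (Finset.sum_range_zero _) (fun i => (hsucc i).trans_lt (hstep i))
      hc hsum
  refine ⟨J, hJN, hJ, hJ₀, fun k i j hi hij hj => (dist_le_Ico_sum_dist y hij).trans_lt ?_⟩
  rw [Finset.sum_Ico_eq_sub _ hij]
  exact hblock k i j hi hij hj

end Ladder

section ChainProduct

variable {X M G : Type*} [Monoid M] [Group G] {e : X → X → G}

/-- The product of the values of `e` over the steps of a chain. The later steps stand further left,
to match the composition order of `FundamentalGroup`. -/
def chainProd (e : X → X → M) : List X → M
  | [] => 1
  | [_] => 1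
  | a :: b :: l => chainProd e (b :: l) * e a b

theorem chainProd_append_cons (e : X → X → M) (l r : List X) (a : X) :
    chainProd e (l ++ a :: r) = chainProd e (a :: r) * chainProd e (l ++ [a]) := by
  induction l with
  | nil => simp [chainProd]
  | cons b l ih =>
    cases l with
    | nil => simp [chainProd]
    | cons c l => simpa [chainProd, mul_assoc] using congrArg (· * e b c) ih

theorem chainProd_initialSegment_succ (e : X → X → M) (y : ℕ → X) (n : ℕ) :
    chainProd e (initialSegment y (n + 1)) =
      e (y n) (y (n + 1)) * chainProd e (initialSegment y n) := by
  rw [initialSegment_succ, initialSegment_eq_append, List.append_assoc, List.singleton_append,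
    chainProd_append_cons]
  simp [chainProd]

theorem chainProd_reverse {l : List X} (h : l.IsChain fun a b => e b a = (e a b)⁻¹) :
    chainProd e l.reverse = (chainProd e l)⁻¹ := by
  induction l using List.twoStepInduction with
  | nil => simp [chainProd]
  | singleton a => simp [chainProd]
  | cons_cons a b l _ ih =>
    rw [List.isChain_cons_cons] at h
    have hl := ih b h.2
    simp only [List.reverse_cons, List.append_assoc, List.singleton_append] at hl ⊢
    rw [chainProd_append_cons, hl]
    simp [chainProd, h.1]

theorem chainProd_roundTrip {e : X → X → M} {y z : ℕ → X} {m n : ℕ} (h : y m = z n)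
    (he : e (y m) (y m) = 1) :
    chainProd e (roundTrip y m z n) =
      chainProd e (initialSegment z n).reverse * chainProd e (initialSegment y m) := by
  have hz : (initialSegment z n).reverse = z n :: ((List.range n).map z).reverse := by
    simp [initialSegment_eq_append]
  rw [roundTrip, hz, initialSegment_eq_append, List.append_assoc, List.singleton_append,
    chainProd_append_cons]
  simp [chainProd, ← h, he]

end ChainProduct

section LocalCocycle

variable {X M G : Type*} [MetricSpace X] [Monoid M] [Group G] {δ : ℝ} {e : X → X → M}
  {α β : List X}

/-- A function on pairs of points that is multiplicative on the triangles of diameter less than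
`δ`. Its product along a `δ`-chain is invariant under `δ`-homotopy. -/
structure IsLocalCocycle (δ : ℝ) (e : X → X → M) : Prop where
  self : ∀ a, e a a = 1
  mul : ∀ {a p b}, dist a p < δ → dist p b < δ → dist a b < δ → e p b * e a p = e a b

theorem IsLocalCocycle.inv {e : X → X → G} (he : IsLocalCocycle δ e) {a b : X}
    (h : dist a b < δ) : e b a = (e a b)⁻¹ := by
  refine eq_inv_of_mul_eq_one_left ?_
  rw [he.mul h (by rwa [dist_comm]) (by simpa using dist_nonneg.trans_lt h), he.self]

theorem IsLocalCocycle.chainProd_eq_of_addsPoint (he : IsLocalCocycle δ e)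
    (h : AddsPoint δ α β) : chainProd e α = chainProd e β := by
  obtain ⟨hα, hβ, hhead, hlast, a, b, p, rfl, rfl⟩ := h
  rcases a.eq_nil_or_concat' with rfl | ⟨a, x, rfl⟩
  · cases b with
    | nil => exact absurd rfl hα.1
    | cons y b =>
      obtain rfl : y = p := by simpa using hhead
      simp [chainProd, he.self]
  · simp only [List.append_assoc, List.singleton_append] at hα hβ hlast ⊢
    cases b with
    | nil =>
      obtain rfl : x = p := by simpa using hlast
      rw [chainProd_append_cons _ _ [x]]
      simp [chainProd, he.self]
    | cons y b =>
      have hxy := hα.2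
      have hxpy := hβ.2
      simp only [List.isChain_append_cons_cons, List.isChain_cons_cons] at hxy hxpy
      rw [chainProd_append_cons _ _ (y :: b), chainProd_append_cons _ _ (p :: y :: b)]
      simp only [chainProd]
      rw [← he.mul hxpy.2.1 hxpy.2.2.1 hxy.2.1]
      simp only [mul_assoc]

theorem IsLocalCocycle.chainProd_eq_of_epsHomotopic (he : IsLocalCocycle δ e)
    (h : EpsHomotopic δ α β) : chainProd e α = chainProd e β := by
  obtain ⟨-, -, h⟩ := h
  induction h with
  | refl => rfl
  | tail _ hmove ih =>
    exact ih.trans (hmove.elim he.chainProd_eq_of_addsPoint fun h =>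
      (he.chainProd_eq_of_addsPoint h).symm)

theorem IsLocalCocycle.chainProd_eq_one_of_isEpsNull (he : IsLocalCocycle δ e)
    (h : IsEpsNull δ α) : chainProd e α = 1 := by
  obtain ⟨x, hx⟩ := h
  rw [he.chainProd_eq_of_epsHomotopic hx, chainProd]

end LocalCocycle

section LoopClass

variable {X : Type*} [TopologicalSpace X] {o : X}

/-- The class of the loop at `o` obtained from a path by joining its endpoints to `o` along the
chosen paths `τ`. It turns path classes with varying endpoints into elements of one group. -/
noncomputable def loopClass (τ : ∀ a : X, Path o a) {a b : X} (p : Path a b) :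
    FundamentalGroup X o :=
  ((Path.Homotopic.Quotient.mk (τ a)).trans (Path.Homotopic.Quotient.mk p)).trans
    (Path.Homotopic.Quotient.mk (τ b)).symm

variable (τ : ∀ a : X, Path o a) {a b c : X}

theorem loopClass_congr {p q : Path a b} (h : p.Homotopic q) : loopClass τ p = loopClass τ q := by
  rw [loopClass, loopClass, Path.Homotopic.Quotient.eq.2 h]

theorem loopClass_refl : loopClass τ (Path.refl a) = 1 := by
  rw [loopClass, Path.Homotopic.Quotient.mk_refl, Path.Homotopic.Quotient.trans_refl,
    Path.Homotopic.Quotient.trans_symm]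
  rfl

theorem loopClass_trans (p : Path a b) (q : Path b c) :
    loopClass τ (p.trans q) = loopClass τ q * loopClass τ p := by
  rw [FundamentalGroup.mul_def]
  simp only [loopClass, Path.Homotopic.Quotient.mk_trans, Path.Homotopic.Quotient.trans_assoc]
  rw [← Path.Homotopic.Quotient.trans_assoc (Path.Homotopic.Quotient.mk (τ b)).symm,
    Path.Homotopic.Quotient.symm_trans, Path.Homotopic.Quotient.refl_trans]

theorem loopClass_cast {a' b' : X} (p : Path a b) (ha : a' = a) (hb : b' = b) :
    loopClass τ (p.cast ha hb) = loopClass τ p := by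
  subst ha hb
  rfl

theorem trans_left_cancel {S : Path.Homotopic.Quotient o a} {P Q : Path.Homotopic.Quotient a b}
    (h : S.trans P = S.trans Q) : P = Q := by
  simpa only [← Path.Homotopic.Quotient.trans_assoc, Path.Homotopic.Quotient.symm_trans,
    Path.Homotopic.Quotient.refl_trans] using congrArg S.symm.trans h

theorem trans_right_cancel {P Q : Path.Homotopic.Quotient a b} {T : Path.Homotopic.Quotient b c}
    (h : P.trans T = Q.trans T) : P = Q := by
  simpa only [Path.Homotopic.Quotient.trans_assoc, Path.Homotopic.Quotient.trans_symm,
    Path.Homotopic.Quotient.trans_refl] using congrArg (·.trans T.symm) h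

theorem homotopic_of_loopClass_eq {p q : Path a b} (h : loopClass τ p = loopClass τ q) :
    p.Homotopic q :=
  Path.Homotopic.Quotient.eq.1 (trans_left_cancel (trans_right_cancel h))

end LoopClass

section Subdivision

variable {X : Type*} [MetricSpace X] {a b : X} {γ : Path a b} {δ c : ℝ}

/-- The times `t 0 ≤ t 1 ≤ ...` run from `0` to `1` in `n` steps, and during each step `γ` stays
within `δ` of the point at which the step starts. -/
structure IsSubdivision (γ : Path a b) (δ : ℝ) (t : ℕ → unitInterval) (n : ℕ) : Prop where
  monotone : Monotone t
  zero : t 0 = 0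
  last : t n = 1
  image_subset : ∀ i, γ '' Set.Icc (t i) (t (i + 1)) ⊆ Metric.ball (γ (t i)) δ

theorem IsSubdivision.dist_lt {t : ℕ → unitInterval} {n : ℕ} (ht : IsSubdivision γ δ t n) (i : ℕ) :
    dist (γ (t i)) (γ (t (i + 1))) < δ := by
  rw [dist_comm]
  exact ht.image_subset i ⟨_, ⟨ht.monotone i.le_succ, le_rfl⟩, rfl⟩

theorem exists_isSubdivision (γ : Path a b) (hδ : 0 < δ) : ∃ t n, IsSubdivision γ δ t n := by
  obtain ⟨t, h₀, hmono, ⟨n, hn⟩, ht⟩ := exists_monotone_Icc_subset_open_cover_unitInterval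
    (c := fun x => γ ⁻¹' Metric.ball x (δ / 2)) (fun _ => Metric.isOpen_ball.preimage γ.continuous)
    fun s _ => Set.mem_iUnion.2 ⟨γ s, Metric.mem_ball_self (half_pos hδ)⟩
  refine ⟨t, n, hmono, h₀, hn n le_rfl, fun i => ?_⟩
  obtain ⟨x, hx⟩ := ht i
  rintro _ ⟨s, hs, rfl⟩
  have hsx : dist (γ s) x < δ / 2 := hx hs
  have htx : dist (γ (t i)) x < δ / 2 := hx ⟨le_rfl, hmono i.le_succ⟩
  exact (dist_triangle_right _ _ x).trans_lt ((add_lt_add hsx htx).trans_eq (add_halves δ))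

theorem exists_subdivision_blocks (hδ : 0 < δ) (hc : 0 ≤ c) {N : ℕ}
    (hγ : pathLength γ < ENNReal.ofReal (N * c)) :
    ∃ t J, IsSubdivision γ δ t (J N) ∧ IsBlockDecomposition (c + δ) (fun i => γ (t i)) J := by
  obtain ⟨t, M, ht⟩ := exists_isSubdivision γ hδ
  have hsum : ∑ i ∈ Finset.range M, dist (γ (t i)) (γ (t (i + 1))) < N * c := by
    have hedist := (eVariationOn.sum_le (f := γ) (s := Set.univ) (n := M) ht.monotone
      fun _ => Set.mem_univ _).trans_lt hγ
    simp only [edist_dist] at hedist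
    rw [← ENNReal.ofReal_sum_of_nonneg fun _ _ => dist_nonneg] at hedist
    simpa only [dist_comm] using (ENNReal.ofReal_lt_ofReal_iff_of_nonneg
      (Finset.sum_nonneg fun _ _ => dist_nonneg)).1 hedist
  obtain ⟨J, rfl, hJ⟩ := exists_isBlockDecomposition (y := fun i => γ (t i)) ht.dist_lt hc hsum
  exact ⟨t, J, ht, hJ⟩

end Subdivision

section LocalPathSystem

variable {X : Type*} [MetricSpace X] {σ : ∀ x y : X, Path x y} {δ δ' : ℝ} {a b : X}

/-- A choice of connecting paths that is unique and additive, up to homotopy, at scale `δ`. It lets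
`δ`-chains represent path classes. -/
structure IsLocalPathSystem (σ : ∀ x y : X, Path x y) (δ : ℝ) : Prop where
  homotopic : ∀ {x y} (p : Path x y), Set.range p ⊆ Metric.ball x δ → p.Homotopic (σ x y)
  trans_homotopic : ∀ {x p y}, dist x p < δ → dist p y < δ → dist x y < δ →
    ((σ x p).trans (σ p y)).Homotopic (σ x y)

theorem IsLocalPathSystem.mono (hσ : IsLocalPathSystem σ δ) (h : δ' ≤ δ) :
    IsLocalPathSystem σ δ' where
  homotopic p hp := hσ.homotopic p (hp.trans (Metric.ball_subset_ball h))
  trans_homotopic hxp hpy hxy :=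
    hσ.trans_homotopic (hxp.trans_le h) (hpy.trans_le h) (hxy.trans_le h)

theorem IsLocalPathSystem.isLocalCocycle (hσ : IsLocalPathSystem σ δ) (hδ : 0 < δ)
    (τ : ∀ x, Path a x) : IsLocalCocycle δ fun x y => loopClass τ (σ x y) where
  self x := by
    have hrefl := hσ.homotopic (Path.refl x) (by simpa using hδ)
    rw [← loopClass_congr τ hrefl, loopClass_refl]
  mul hxp hpy hxy := by
    rw [← loopClass_trans, loopClass_congr τ (hσ.trans_homotopic hxp hpy hxy)]

theorem IsLocalPathSystem.chainProd_initialSegment (hσ : IsLocalPathSystem σ δ) {o : X}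
    (τ : ∀ x, Path o x) {γ : Path a b} {t : ℕ → unitInterval} {n : ℕ}
    (ht : IsSubdivision γ δ t n) :
    chainProd (fun x y => loopClass τ (σ x y)) (initialSegment (fun i => γ (t i)) n) =
      loopClass τ γ := by
  have hstep : ∀ i, (γ.subpath (t i) (t (i + 1))).Homotopic (σ (γ (t i)) (γ (t (i + 1)))) :=
    fun i => hσ.homotopic _ <| by
      rw [Path.range_subpath_of_le _ _ _ (ht.monotone i.le_succ)]
      exact ht.image_subset i
  have hpartial : ∀ k, chainProd (fun x y => loopClass τ (σ x y))
      (initialSegment (fun i => γ (t i)) k) = loopClass τ (γ.subpath (t 0) (t k)) := by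
    intro k
    induction k with
    | zero =>
      rw [Path.subpath_self, loopClass_refl]
      rfl
    | succ k ih =>
      rw [chainProd_initialSegment_succ, ih, ← loopClass_congr τ (hstep k), ← loopClass_trans]
      exact loopClass_congr τ ⟨Path.Homotopy.subpathTransSubpath γ _ _ _⟩
  rw [hpartial, ht.zero, ht.last, Path.subpath_zero_one, loopClass_cast]

theorem IsLocalPathSystem.homotopic_of_isEpsNull (hσ : IsLocalPathSystem σ δ) (hδ : 0 < δ)
    {γ γ' : Path a b} {t t' : ℕ → unitInterval} {m n : ℕ}
    (ht : IsSubdivision γ δ t m) (ht' : IsSubdivision γ' δ t' n)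
    (hnull : IsEpsNull δ (roundTrip (fun i => γ (t i)) m (fun i => γ' (t' i)) n)) :
    γ.Homotopic γ' := by
  have he := hσ.isLocalCocycle hδ (σ a)
  have hprod := he.chainProd_eq_one_of_isEpsNull hnull
  rw [chainProd_roundTrip (by simp [ht.last, ht'.last]) (he.self _),
    chainProd_reverse (isChain_initialSegment.2 fun i _ => he.inv (ht'.dist_lt i)),
    hσ.chainProd_initialSegment _ ht, hσ.chainProd_initialSegment _ ht', inv_mul_eq_one] at hprod
  exact homotopic_of_loopClass_eq (σ a) hprod.symm

end LocalPathSystem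

section SmallScale

variable {X : Type*} [MetricSpace X] [CompactSpace X] [LocallyPathConnectedSpace X]

theorem exists_pos_ball_subset_isPathConnected {U : X → Set X} (hU : ∀ x, U x ∈ 𝓝 x) :
    ∃ r > 0, ∀ y, ∃ x V, IsPathConnected V ∧ x ∈ V ∧ V ⊆ U x ∧ Metric.ball y r ⊆ V := by
  choose V hV hVU using fun x => (isOpen_isPathConnected_basis x).mem_iff.1 (hU x)
  obtain ⟨r, hr, hball⟩ := lebesgue_number_lemma_of_metric (isCompact_univ (X := X))
    (fun x => (hV x).1) fun x _ => Set.mem_iUnion.2 ⟨x, (hV x).2.1⟩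
  refine ⟨r, hr, fun y => ?_⟩
  obtain ⟨x, hx⟩ := hball y (Set.mem_univ y)
  exact ⟨x, V x, (hV x).2.2, (hV x).2.1, hVU x, hx⟩

theorem exists_pos_homotopic_of_subset_ball (hslsc : IsSemilocallySimplyConnected X) :
    ∃ r > 0, ∀ (c a b : X) (p q : Path a b), Set.range p ⊆ Metric.ball c r →
      Set.range q ⊆ Metric.ball c r → p.Homotopic q := by
  choose U hU hnull using hslsc
  obtain ⟨r, hr, hball⟩ := exists_pos_ball_subset_isPathConnected hU
  refine ⟨r, hr, fun c a b p q hp hq => ?_⟩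
  obtain ⟨x, V, hV, hxV, hVU, hcV⟩ := hball c
  replace hp := hp.trans hcV
  replace hq := hq.trans hcV
  obtain ⟨s, hs⟩ := hV.joinedIn x hxV a (hp ⟨0, p.source⟩)
  have hloop := hnull x ((s.trans p).trans (s.trans q).symm) <| by
    simp only [Path.trans_range, Path.symm_range]
    have hsV := Set.range_subset_iff.2 hs
    exact (Set.union_subset (Set.union_subset hsV hp) (Set.union_subset hsV hq)).trans hVU
  have hquot : (Path.Homotopic.Quotient.mk (s.trans p)).trans
      (Path.Homotopic.Quotient.mk (s.trans q)).symm =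
        (Path.Homotopic.Quotient.mk (s.trans q)).trans
          (Path.Homotopic.Quotient.mk (s.trans q)).symm := by
    rw [Path.Homotopic.Quotient.trans_symm]
    exact Path.Homotopic.Quotient.eq.2 hloop
  rw [Path.Homotopic.Quotient.mk_trans, Path.Homotopic.Quotient.mk_trans] at hquot
  exact Path.Homotopic.Quotient.eq.1 (trans_left_cancel (trans_right_cancel hquot))

theorem exists_pos_path_in_ball {r : ℝ} (hr : 0 < r) :
    ∃ δ > 0, ∀ x y : X, dist x y < δ → ∃ p : Path x y, Set.range p ⊆ Metric.ball x r := by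
  obtain ⟨δ, hδ, hball⟩ := exists_pos_ball_subset_isPathConnected
    fun x : X => Metric.ball_mem_nhds x (half_pos hr)
  refine ⟨δ, hδ, fun x y hxy => ?_⟩
  obtain ⟨c, V, hV, -, hVc, hxV⟩ := hball x
  have hx : x ∈ V := hxV (Metric.mem_ball_self hδ)
  obtain ⟨p, hp⟩ := hV.joinedIn x hx y (hxV (by rwa [Metric.mem_ball, dist_comm]))
  refine ⟨p, Set.range_subset_iff.2 fun t => ?_⟩
  have hpc : dist (p t) c < r / 2 := hVc (hp t)
  have hxc : dist x c < r / 2 := hVc hx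
  exact (dist_triangle_right _ _ c).trans_lt ((add_lt_add hpc hxc).trans_eq (add_halves r))

theorem exists_isLocalPathSystem [PathConnectedSpace X] (hslsc : IsSemilocallySimplyConnected X) :
    ∃ σ : ∀ x y : X, Path x y, ∃ δ > 0, IsLocalPathSystem σ δ := by
  obtain ⟨r, hr, hsmall⟩ := exists_pos_homotopic_of_subset_ball hslsc
  obtain ⟨δ, hδ, hpath⟩ := exists_pos_path_in_ball (X := X) (half_pos hr)
  have hex : ∀ x y : X, ∃ p : Path x y, dist x y < δ → Set.range p ⊆ Metric.ball x (r / 2) :=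
    fun x y => by
      by_cases hxy : dist x y < δ
      · exact (hpath x y hxy).imp fun p hp _ => hp
      · exact ⟨PathConnectedSpace.somePath x y, fun h => absurd h hxy⟩
  choose σ hσ using hex
  have hσr : ∀ {x y}, dist x y < δ → Set.range (σ x y) ⊆ Metric.ball x r := fun h =>
    (hσ _ _ h).trans (Metric.ball_subset_ball (half_le_self hr.le))
  refine ⟨σ, min δ (r / 2), lt_min hδ (half_pos hr), fun {x y} p hp => ?_,
    fun {x p y} hxp hpy hxy => ?_⟩
  · have hy : dist y x < min δ (r / 2) := hp ⟨1, p.target⟩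
    refine hsmall x _ _ _ _ (hp.trans (Metric.ball_subset_ball ?_))
      (hσr (by rw [dist_comm]; exact hy.trans_le (min_le_left _ _)))
    exact (min_le_right _ _).trans (half_le_self hr.le)
  · rw [lt_min_iff] at hxp hpy hxy
    refine hsmall x _ _ _ _ ?_ (hσr hxy.1)
    rw [Path.trans_range]
    refine Set.union_subset (hσr hxp.1) ((hσ p y hpy.1).trans (Metric.ball_subset_ball' ?_))
    linarith [hxp.2, dist_comm x p]

end SmallScale

section Geodesic

variable {X : Type*} [MetricSpace X]

theorem IsGeodesicSpace.exists_path (hgeo : IsGeodesicSpace X) (x y : X) :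
    ∃ p : Path x y, Set.range p ⊆ Metric.closedBall x (dist x y) := by
  obtain ⟨c, h₀, h₁, hc⟩ := hgeo x y
  have hmem : ∀ t : unitInterval, (t : ℝ) * dist x y ∈ Set.Icc 0 (dist x y) := fun t =>
    ⟨mul_nonneg t.2.1 dist_nonneg, mul_le_of_le_one_left dist_nonneg t.2.2⟩
  have hcont : ContinuousOn c (Set.Icc 0 (dist x y)) := by
    refine (LipschitzOnWith.of_dist_le_mul (K := 1) fun s hs t ht => ?_).continuousOn
    rw [hc s hs t ht, Real.dist_eq, NNReal.coe_one, one_mul]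
  refine ⟨⟨⟨fun t => c (t * dist x y), ?_⟩, by simpa using h₀, by simpa using h₁⟩, ?_⟩
  · exact hcont.comp_continuous (by fun_prop) hmem
  · rintro _ ⟨t, rfl⟩
    have hdist := hc _ (hmem t) 0 ⟨le_rfl, dist_nonneg⟩
    rw [h₀, sub_zero, abs_of_nonneg (hmem t).1] at hdist
    exact hdist.trans_le (hmem t).2

theorem IsGeodesicSpace.preconnectedSpace (hgeo : IsGeodesicSpace X) : PreconnectedSpace X := by
  rcases isEmpty_or_nonempty X with hX | hX
  · infer_instance
  · have : PathConnectedSpace X := ⟨hX, fun x y => ⟨(hgeo.exists_path x y).choose⟩⟩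
    infer_instance

theorem IsGeodesicSpace.locallyPathConnectedSpace (hgeo : IsGeodesicSpace X) :
    LocallyPathConnectedSpace X := by
  refine .of_bases (fun x => Metric.nhds_basis_ball) fun x r hr => ?_
  refine ⟨x, Metric.mem_ball_self hr, fun {y} hy => ?_⟩
  obtain ⟨p, hp⟩ := hgeo.exists_path x y
  rw [Metric.mem_ball'] at hy
  exact ⟨p, Set.range_subset_iff.1 (hp.trans (Metric.closedBall_subset_ball hy))⟩

end Geodesic

section Counting

variable {X : Type*} [MetricSpace X]

theorem homotopic_of_rungs {σ : ∀ x y : X, Path x y} {δ ε s c : ℝ} (hσ : IsLocalPathSystem σ δ)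
    (hδ : 0 < δ) (hlower : ε ∈ lowerBounds (homotopyCriticalSpectrum X)) (hδε : δ ≤ ε)
    (hs : s + c ≤ ε) {x y : X} {γ γ' : Path x y} {t t' : ℕ → unitInterval} {J J' : ℕ → ℕ} {N : ℕ}
    (ht : IsSubdivision γ δ t (J N)) (hJ : IsBlockDecomposition c (fun i => γ (t i)) J)
    (ht' : IsSubdivision γ' δ t' (J' N)) (hJ' : IsBlockDecomposition c (fun i => γ' (t' i)) J')
    (hrung : ∀ k < N, dist (γ (t (J k))) (γ' (t' (J' k))) < s) : γ.Homotopic γ' := by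
  have h₀ : γ (t 0) = γ' (t' 0) := by simp [ht.zero, ht'.zero]
  have hlast : γ (t (J N)) = γ' (t' (J' N)) := by simp [ht.last, ht'.last]
  have hloop := isEpsLoop_roundTrip (y := fun i => γ (t i)) (z := fun i => γ' (t' i)) hδ
    (fun i _ => ht.dist_lt i) (fun i _ => ht'.dist_lt i) h₀ hlast
  have hnull := IsEpsNull.of_ladder hJ hJ' hs h₀ hrung (hloop.1.mono hδε)
  exact hσ.homotopic_of_isEpsNull hδ ht ht' (hnull.of_mem_lowerBounds hlower hδ hloop)

theorem exists_pathLength_lt_of_classLength_lt {x y : X} {g : Path.Homotopic.Quotient x y}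
    {l : ℝ≥0∞} (h : classLength g < l) :
    ∃ γ : Path x y, Path.Homotopic.Quotient.mk γ = g ∧ pathLength γ < l := by
  simpa only [classLength, iInf_lt_iff, exists_prop] using h

theorem encard_setOf_classLength_lt_le {σ : ∀ x y : X, Path x y} {δ₀ ε s c : ℝ}
    (hσ : IsLocalPathSystem σ δ₀) (hδ₀ : 0 < δ₀)
    (hlower : ε ∈ lowerBounds (homotopyCriticalSpectrum X)) (hs : 0 < s) (hc : 0 ≤ c)
    (hsc : 2 * s + c < ε) {A : Set X} (hA : ⋃ a ∈ A, Metric.ball a s = Set.univ) (x y : X)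
    (n : ℕ) :
    {g : Path.Homotopic.Quotient x y |
      classLength g < ENNReal.ofReal ((n + 1 : ℕ) * c)}.encard ≤ A.encard ^ n := by
  obtain ⟨δ, hδ, hδδ₀, hδε⟩ : ∃ δ > 0, δ ≤ δ₀ ∧ δ ≤ ε - (2 * s + c) :=
    ⟨_, lt_min hδ₀ (sub_pos.2 hsc), min_le_left _ _, min_le_right _ _⟩
  let S := {g : Path.Homotopic.Quotient x y | classLength g < ENNReal.ofReal ((n + 1 : ℕ) * c)}
  choose γ hγ hlength using fun g : S => exists_pathLength_lt_of_classLength_lt g.2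
  choose t J ht hJ using fun g => exists_subdivision_blocks hδ hc (hlength g)
  have hcover : ∀ z : X, ∃ a : A, dist z a < s := fun z => by
    simpa using hA.ge (Set.mem_univ z)
  choose center hcenter using hcover
  let record : S → Fin n → A := fun g k => center (γ g (t g (J g (k + 1))))
  have hrecord : Function.Injective record := by
    intro g h hgh
    have hrung : ∀ k < n + 1, dist (γ g (t g (J g k))) (γ h (t h (J h k))) < 2 * s := by
      rintro (_ | k) hk
      · simpa [(ht _).zero, (hJ _).zero] using hs
      · have hcommon : center (γ g (t g (J g (k + 1)))) = center (γ h (t h (J h (k + 1)))) :=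
          congrFun hgh ⟨k, by omega⟩
        rw [two_mul]
        exact (dist_triangle_right _ _ _).trans_lt
          (add_lt_add (hcenter _) (hcommon ▸ hcenter _))
    have hhom := homotopic_of_rungs (hσ.mono hδδ₀) hδ hlower (by linarith) (by linarith)
      (ht g) (hJ g) (ht h) (hJ h) hrung
    exact Subtype.ext ((hγ g).symm.trans ((Path.Homotopic.Quotient.eq.2 hhom).trans (hγ h)))
  have hcard := ENat.card_le_card_of_injective hrecord
  rwa [ENat.card_fun, ENat.card_coe_set_eq, ENat.card_coe_set_eq, ENat.card_eq_coe_fintype_card,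
    Fintype.card_fin, ENat.epow_natCast] at hcard

variable (X) in
theorem exists_cover_encard_eq_openCoverNumber {s : ℝ} (hs : 0 < s) :
    ∃ A : Set X, ⋃ a ∈ A, Metric.ball a s = Set.univ ∧ A.encard = openCoverNumber X s := by
  have hne : Nonempty {A : Set X // ⋃ a ∈ A, Metric.ball a s = Set.univ} :=
    ⟨Set.univ, Set.eq_univ_of_forall fun x =>
      Set.mem_biUnion (Set.mem_univ x) (Metric.mem_ball_self hs)⟩
  obtain ⟨A, hA⟩ := ENat.exists_eq_iInf
    fun A : {A : Set X // ⋃ a ∈ A, Metric.ball a s = Set.univ} => A.1.encard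
  exact ⟨A.1, A.2, by rw [openCoverNumber, iInf_subtype', hA]⟩

theorem one_le_openCoverNumber [Nonempty X] (s : ℝ) : 1 ≤ openCoverNumber X s := by
  refine le_iInf₂ fun A hA => Set.one_le_encard_iff_nonempty.2 ?_
  rw [Set.nonempty_iff_ne_empty]
  rintro rfl
  simp [Set.empty_ne_univ] at hA

theorem shortClassCount_le_openCoverNumber_pow [CompactSpace X] [PathConnectedSpace X]
    [LocallyPathConnectedSpace X] (hslsc : IsSemilocallySimplyConnected X) {ε s c L : ℝ}
    (hlower : ε ∈ lowerBounds (homotopyCriticalSpectrum X)) (hs : 0 < s) (hc : 0 < c)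
    (hsc : 2 * s + c < ε) {n : ℕ} (hL : L < (n + 1 : ℕ) * c) :
    shortClassCount X L ≤ openCoverNumber X s ^ n := by
  obtain ⟨σ, δ, hδ, hσ⟩ := exists_isLocalPathSystem hslsc
  obtain ⟨A, hA, hcard⟩ := exists_cover_encard_eq_openCoverNumber X hs
  have hlt : ENNReal.ofReal L < ENNReal.ofReal ((n + 1 : ℕ) * c) :=
    (ENNReal.ofReal_lt_ofReal_iff (by positivity)).2 hL
  rw [← hcard]
  exact iSup_le fun x => (Set.encard_le_encard fun g hg => lt_of_le_of_lt hg hlt).trans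
    (encard_setOf_classLength_lt_le hσ hδ hlower hs hc.le hsc hA x x n)

end Counting

end DiscreteHomotopy

open DiscreteHomotopy in
theorem corollary4_general (X : Type*) [MetricSpace X] [CompactSpace X] [PreconnectedSpace X]
    [LocallyPathConnectedSpace X] (hslsc : IsSemilocallySimplyConnected X) (ε : ℝ) (hε : 0 < ε)
    (hlower : ε ∈ lowerBounds (homotopyCriticalSpectrum X)) (L : ℝ) (hL : 0 ≤ L) :
    (shortClassCount X L : ENNReal) ≤ (openCoverNumber X (ε / 4) : ENNReal) ^ (4 * L / ε) := by
  rcases isEmpty_or_nonempty X with hX | hX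
  · simp [shortClassCount]
  have : ConnectedSpace X := ⟨hX⟩
  have : PathConnectedSpace X := .of_locallyPathConnectedSpace
  set n := ⌊4 * L / ε⌋₊
  have hlength : L < (n + 1 : ℕ) * (ε / 4) := by
    have hfloor := Nat.lt_floor_add_one (4 * L / ε)
    rw [div_lt_iff₀ hε] at hfloor
    push_cast
    linarith
  have hcount : shortClassCount X L ≤ openCoverNumber X (ε / 4) ^ n :=
    shortClassCount_le_openCoverNumber_pow hslsc hlower (by positivity) (by positivity)
      (by linarith) hlength
  have hone : (1 : ENNReal) ≤ openCoverNumber X (ε / 4) := by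
    exact_mod_cast one_le_openCoverNumber (X := X) (ε / 4)
  calc (shortClassCount X L : ENNReal)
      ≤ (openCoverNumber X (ε / 4) : ENNReal) ^ n := by
        rw [← ENat.toENNReal_pow]
        exact ENat.toENNReal_le.2 hcount
    _ = (openCoverNumber X (ε / 4) : ENNReal) ^ (n : ℝ) := (ENNReal.rpow_natCast _ _).symm
    _ ≤ (openCoverNumber X (ε / 4) : ENNReal) ^ (4 * L / ε) :=
        ENNReal.rpow_le_rpow_of_exponent_le hone (Nat.floor_le (by positivity))

theorem corollary4 (X : Type*) [MetricSpace X] [CompactSpace X]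
    (hgeo : DiscreteHomotopy.IsGeodesicSpace X)
    (hslsc : DiscreteHomotopy.IsSemilocallySimplyConnected X)
    (ε : ℝ) (hε : 0 < ε)
    (hlower : ε ∈ lowerBounds (DiscreteHomotopy.homotopyCriticalSpectrum X))
    (L : ℝ) (hL : 0 < L) :
    (DiscreteHomotopy.shortClassCount X L : ENNReal) ≤
      (DiscreteHomotopy.openCoverNumber X (ε / 4) : ENNReal) ^ (4 * L / ε) := by
  have := hgeo.preconnectedSpace
  have := hgeo.locallyPathConnectedSpace
  exact corollary4_general X hslsc ε hε hlower L hL.le
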